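/- Let $G$ be a finite connected undirected graph without loops on a vertex set $V$ with at least two vertices, with positive edge weights $c_{uv}=c_{vu}$ (and $c_{uv}=0$ for non-edges). Put $c_v=\sum_u c_{uv}$, let $D$ be the diagonal matrix of the degrees $c_v$, let $L=D-(c_{uv})_{u,v}$ be the Laplacian, $N=D^{-1/2}LD^{-1/2}$ the normalized Laplacian, and $\lambda_G$ the smallest nonzero eigenvalue of $N$. For a nonempty set $X\subseteq V$, let $\mathrm{Schur}(G,X)$ be the weighted graph on $X$ whose Laplacian is the Schur complement $$L[X,X]-L[X,V\setminus X]\,L[V\setminus X,V\setminus X]^{-1}\,L[V\setminus X,X].$$ For disjoint nonempty $A,B\subseteq V$, put $I=\mathrm{Schur}(G,A\cup B)$ and $$\rho_{A,B}=\frac{c^I(A,B)}{\min(\mathrm{vol}_I(A),\mathrm{vol}_I(B))},$$ where $c^I(A,B)$ is the total weight of the edges of $I$ between $A$ and $B$, and $\mathrm{vol}_I(S)$ is the sum of the weighted degrees in $I$ of the vertices of $S$. Let $\rho_G=\min_{A,B}\rho_{A,B}$ over all pairs of disjoint nonempty sets $A,B\subseteq V$. Then both minima $\lambda_G$ and $\rho_G$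 exist, and $$\frac{\lambda_G}{2}\le\rho_G\le 25600\,\lambda_G.$$ -/

import Mathlib

open scoped Matrix

/-- A finite weighted undirected graph on `V`, given by its symmetric nonnegative edge weights;
`u` and `v` are joined by an edge exactly when `0 < c u v`. There are no loops. -/
structure WeightedGraph (V : Type*) where
  c : V → V → ℝ
  symm : ∀ u v, c u v = c v u
  nonneg : ∀ u v, 0 ≤ c u v
  loopless : ∀ v, c v v = 0

namespace WeightedGraph

noncomputable section

variable {V : Type*}

/-- The underlying simple graph, whose edges are the pairs of positive weight. -/
def support (G : WeightedGraph V) : SimpleGraph V where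
  Adj u v := 0 < G.c u v
  symm := ⟨fun u v h => by rw [G.symm v u]; exact h⟩
  loopless := ⟨fun v h => by simp [G.loopless v] at h⟩

/-- The graph is connected (through edges of positive weight). -/
def Connected (G : WeightedGraph V) : Prop := G.support.Connected

/-- Total weight of the edges between `A` and `B`, for disjoint `A` and `B`. -/
def cut (G : WeightedGraph V) (A B : Finset V) : ℝ := ∑ a ∈ A, ∑ b ∈ B, G.c a b

variable [Fintype V]

/-- Weighted degree of a vertex. -/
def deg (G : WeightedGraph V) (v : V) : ℝ := ∑ u, G.c v u

/-- Volume of a vertex set: the sum of the weighted degrees. -/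
def vol (G : WeightedGraph V) (A : Finset V) : ℝ := ∑ v ∈ A, G.deg v

theorem energy_eq_zero (G : WeightedGraph V) (n : V → ℝ)
    (h : ∑ v, ∑ u, G.c v u * (n v - n u) ^ 2 ≤ 0) (v u : V) : G.c v u * (n v - n u) = 0 := by
  have h0 : ∀ v u, 0 ≤ G.c v u * (n v - n u) ^ 2 := fun v u =>
    mul_nonneg (G.nonneg v u) (sq_nonneg _)
  have h1 : G.c v u * (n v - n u) ^ 2 ≤ 0 :=
    calc G.c v u * (n v - n u) ^ 2 ≤ ∑ u, G.c v u * (n v - n u) ^ 2 :=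
          Finset.single_le_sum (f := fun u => G.c v u * (n v - n u) ^ 2)
            (fun u _ => h0 v u) (Finset.mem_univ u)
      _ ≤ ∑ v, ∑ u, G.c v u * (n v - n u) ^ 2 :=
          Finset.single_le_sum (f := fun v => ∑ u, G.c v u * (n v - n u) ^ 2)
            (fun v _ => Finset.sum_nonneg fun u _ => h0 v u) (Finset.mem_univ v)
      _ ≤ 0 := h
  rcases mul_eq_zero.mp (le_antisymm h1 (h0 v u)) with h2 | h2
  · simp [h2]
  · simp [pow_eq_zero_iff two_ne_zero |>.mp h2]

variable [DecidableEq V]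

/-- The Laplacian matrix `D - A`. -/
def laplacian (G : WeightedGraph V) : Matrix V V ℝ :=
  Matrix.diagonal G.deg - Matrix.of G.c

/-- The normalized Laplacian matrix `D^{-1/2} L D^{-1/2}`. -/
def normLaplacian (G : WeightedGraph V) : Matrix V V ℝ :=
  Matrix.diagonal (fun v => (√(G.deg v))⁻¹) * G.laplacian *
    Matrix.diagonal (fun v => (√(G.deg v))⁻¹)

/-- The nonzero eigenvalues of the normalized Laplacian. -/
def nonzeroEigenvalues (G : WeightedGraph V) : Set ℝ :=
  {μ | μ ≠ 0 ∧ Module.End.HasEigenvalue (Matrix.toLin' G.normLaplacian) μ}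

/-- The smallest nonzero eigenvalue of the normalized Laplacian. -/
def spectralGap (G : WeightedGraph V) : ℝ := sInf G.nonzeroEigenvalues

/-- The Schur complement of the Laplacian onto the rows and columns indexed by `X`. -/
def schurMatrix (G : WeightedGraph V) (X : Finset V) :
    Matrix {v // v ∈ X} {v // v ∈ X} ℝ :=
  G.laplacian.submatrix (fun v => v.1) (fun v => v.1) -
    G.laplacian.submatrix (fun v => v.1) (fun v : {v // v ∉ X} => v.1) *
      (G.laplacian.submatrix (fun v : {v // v ∉ X} => v.1) (fun v : {v // v ∉ X} => v.1))⁻¹ *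
      G.laplacian.submatrix (fun v : {v // v ∉ X} => v.1) (fun v => v.1)

/-! Facts that make the Schur complement a weighted graph. -/

theorem laplacian_symm (G : WeightedGraph V) : G.laplacianᵀ = G.laplacian := by
  ext u v
  by_cases h : u = v
  · subst h; simp
  · simp [laplacian, h, Ne.symm h, G.symm u v]

theorem laplacian_nonpos (G : WeightedGraph V) {u v : V} (h : u ≠ v) : G.laplacian u v ≤ 0 := by
  simp [laplacian, h, G.nonneg u v]

theorem laplacian_mulVec (G : WeightedGraph V) (y : V → ℝ) (v : V) :
    (G.laplacian *ᵥ y) v = ∑ u, G.c v u * (y v - y u) := by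
  simp only [laplacian, Matrix.sub_mulVec, Pi.sub_apply, Matrix.mulVec_diagonal, mul_sub,
    Finset.sum_sub_distrib, deg, ← Finset.sum_mul]
  rfl

theorem sum_mul_laplacian (G : WeightedGraph V) (n y : V → ℝ) :
    2 * ∑ v, n v * (G.laplacian *ᵥ y) v = ∑ v, ∑ u, G.c v u * ((n v - n u) * (y v - y u)) := by
  have h1 : ∑ v, n v * (G.laplacian *ᵥ y) v = ∑ v, ∑ u, n v * (G.c v u * (y v - y u)) := by
    simp only [laplacian_mulVec, Finset.mul_sum]
  have h2 : ∑ v, n v * (G.laplacian *ᵥ y) v = ∑ v, ∑ u, n u * (G.c v u * (y u - y v)) := by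
    rw [h1, Finset.sum_comm]
    refine Finset.sum_congr rfl fun v _ => Finset.sum_congr rfl fun u _ => ?_
    rw [G.symm u v]
  rw [two_mul]
  nth_rewrite 1 [h1]
  rw [h2, ← Finset.sum_add_distrib]
  refine Finset.sum_congr rfl fun v _ => ?_
  rw [← Finset.sum_add_distrib]
  exact Finset.sum_congr rfl fun u _ => by ring

/-- Extension by zero of a vector on the eliminated vertices. -/
def extend (X : Finset V) (x : {v // v ∉ X} → ℝ) (v : V) : ℝ := if h : v ∉ X then x ⟨v, h⟩ else 0

theorem submatrix_mulVec_extend (G : WeightedGraph V) (X : Finset V) (x : {v // v ∉ X} → ℝ)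
    (v : {v // v ∉ X}) :
    (G.laplacian.submatrix (fun v : {v // v ∉ X} => v.1) (fun v : {v // v ∉ X} => v.1) *ᵥ x) v =
      (G.laplacian *ᵥ extend X x) v.1 := by
  simp only [Matrix.mulVec, dotProduct, Matrix.submatrix_apply]
  rw [← Fintype.sum_subtype_add_sum_subtype (fun v => v ∉ X)
    (fun u => G.laplacian v.1 u * extend X x u)]
  have h : ∑ u : {u // ¬ u ∉ X}, G.laplacian v.1 u.1 * extend X x u.1 = 0 :=
    Finset.sum_eq_zero fun u _ => by simp [extend, not_not.mp u.2]
  rw [h, add_zero]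
  exact Finset.sum_congr rfl fun u _ => by simp [extend, u.2]

theorem inv_submatrix_nonneg (G : WeightedGraph V) (X : Finset V) (i j : {v // v ∉ X}) :
    0 ≤ (G.laplacian.submatrix (fun v : {v // v ∉ X} => v.1)
      (fun v : {v // v ∉ X} => v.1))⁻¹ i j := by
  have hext := G.submatrix_mulVec_extend X
  set M := G.laplacian.submatrix (fun v : {v // v ∉ X} => v.1) (fun v : {v // v ∉ X} => v.1)
    with hM
  by_cases hu : IsUnit M.det
  swap
  · simp [Matrix.nonsing_inv_apply_not_isUnit _ hu]
  set x : {v // v ∉ X} → ℝ := M⁻¹ *ᵥ Pi.single j 1 with hx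
  have hxi : x i = M⁻¹ i j := by simp [hx]
  have hMx : M *ᵥ x = Pi.single j 1 := by
    rw [hx, Matrix.mulVec_mulVec, Matrix.mul_nonsing_inv _ hu, Matrix.one_mulVec]
  set m : {v // v ∉ X} → ℝ := fun v => max (-x v) 0 with hm
  set n := extend X m with hn
  set y := extend X x with hy
  have hny : ∀ v, n v = max (-y v) 0 := by
    intro v
    by_cases h : v ∈ X <;> simp [hn, hy, extend, h, hm]
  have h1 : 0 ≤ ∑ v, n v * (G.laplacian *ᵥ y) v := by
    refine Finset.sum_nonneg fun v _ => ?_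
    by_cases h : v ∈ X
    · simp [hn, extend, h]
    · refine mul_nonneg (by rw [hny]; exact le_max_right _ _) ?_
      have := hext x ⟨v, h⟩
      rw [hMx] at this
      rw [← this, Pi.single_apply]
      split_ifs <;> norm_num
  have h2 : ∑ v, ∑ u, G.c v u * ((n v - n u) * (y v - y u)) ≤
      -∑ v, ∑ u, G.c v u * (n v - n u) ^ 2 := by
    rw [← Finset.sum_neg_distrib]
    refine Finset.sum_le_sum fun v _ => ?_
    rw [← Finset.sum_neg_distrib]
    refine Finset.sum_le_sum fun u _ => ?_
    rw [← mul_neg]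
    refine mul_le_mul_of_nonneg_left ?_ (G.nonneg v u)
    rw [hny v, hny u]
    rcases max_cases (-y v) 0 with ⟨e1, e2⟩ | ⟨e1, e2⟩ <;>
      rcases max_cases (-y u) 0 with ⟨e3, e4⟩ | ⟨e3, e4⟩ <;> rw [e1, e3] <;> nlinarith
  have h3 := G.energy_eq_zero n (by have := G.sum_mul_laplacian n y; linarith)
  have h4 : M *ᵥ m = 0 := by
    ext v
    rw [hext m v, laplacian_mulVec]
    exact Finset.sum_eq_zero fun u _ => h3 _ _
  have h5 : m = 0 := by
    have : M⁻¹ *ᵥ (M *ᵥ m) = m := by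
      rw [Matrix.mulVec_mulVec, Matrix.nonsing_inv_mul _ hu, Matrix.one_mulVec]
    rw [← this, h4, Matrix.mulVec_zero]
  have h6 : max (-x i) 0 = 0 := congrFun h5 i
  have h7 := le_max_left (-x i) 0
  rw [← hxi]
  linarith

theorem schurMatrix_symm (G : WeightedGraph V) (X : Finset V) (u v : {v // v ∈ X}) :
    G.schurMatrix X u v = G.schurMatrix X v u := by
  have : (G.schurMatrix X)ᵀ = G.schurMatrix X := by
    simp [schurMatrix, Matrix.transpose_mul, Matrix.transpose_nonsing_inv,
      Matrix.transpose_submatrix, laplacian_symm, Matrix.mul_assoc]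
  exact congrFun (congrFun this v) u

theorem schurMatrix_nonpos (G : WeightedGraph V) (X : Finset V) {u v : {v // v ∈ X}}
    (h : u ≠ v) : G.schurMatrix X u v ≤ 0 := by
  have h1 : G.laplacian u.1 v.1 ≤ 0 := G.laplacian_nonpos fun e => h (Subtype.ext e)
  simp only [schurMatrix, Matrix.sub_apply, Matrix.mul_apply, Matrix.submatrix_apply]
  refine sub_nonpos.mpr (h1.trans (Finset.sum_nonneg fun j _ => ?_))
  refine mul_nonneg_of_nonpos_of_nonpos (Finset.sum_nonpos fun i _ => ?_) ?_
  · exact mul_nonpos_of_nonpos_of_nonneg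
      (G.laplacian_nonpos fun e => i.2 (e ▸ u.2)) (G.inv_submatrix_nonneg X i j)
  · exact G.laplacian_nonpos fun e => j.2 (e ▸ v.2)

/-- The Schur complement of `G` onto `X`: the weighted graph on `X` whose Laplacian is
`G.schurMatrix X` (see `laplacian_schur`). -/
def schur (G : WeightedGraph V) (X : Finset V) : WeightedGraph {v // v ∈ X} where
  c u v := if u = v then 0 else -G.schurMatrix X u v
  symm u v := by
    by_cases h : u = v
    · simp [h]
    · simp [h, Ne.symm h, G.schurMatrix_symm X u v]
  nonneg u v := by
    by_cases h : u = v
    · simp [h]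
    · simpa [h] using G.schurMatrix_nonpos X h
  loopless v := by simp

theorem isUnit_det_submatrix (G : WeightedGraph V) (hG : G.Connected) {X : Finset V}
    (hX : X.Nonempty) :
    IsUnit (G.laplacian.submatrix (fun v : {v // v ∉ X} => v.1)
      (fun v : {v // v ∉ X} => v.1)).det := by
  have hext := G.submatrix_mulVec_extend X
  set M := G.laplacian.submatrix (fun v : {v // v ∉ X} => v.1) (fun v : {v // v ∉ X} => v.1)
  rw [isUnit_iff_ne_zero]
  intro hdet
  obtain ⟨x, hx0, hx⟩ := Matrix.exists_mulVec_eq_zero_iff.mpr hdet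
  apply hx0
  have h1 : ∑ v, extend X x v * (G.laplacian *ᵥ extend X x) v = 0 := by
    refine Finset.sum_eq_zero fun v _ => ?_
    by_cases h : v ∈ X
    · simp [extend, h]
    · rw [← hext x ⟨v, h⟩, hx]; simp
  have h2 := G.sum_mul_laplacian (extend X x) (extend X x)
  have h3 := G.energy_eq_zero (extend X x) (by
    simp only [pow_two]; rw [← h2, h1]; simp)
  have h4 : ∀ u v, G.support.Reachable u v → extend X x u = extend X x v := by
    rintro u v ⟨p⟩
    induction p with
    | nil => rfl
    | cons h p ih =>
      rw [← ih]
      have := (mul_eq_zero.mp (h3 _ _)).resolve_left (ne_of_gt h)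
      linarith
  obtain ⟨w, hw⟩ := hX
  ext v
  have := h4 v.1 w (hG.preconnected _ _)
  simpa [extend, hw, v.2] using this

/-- For a connected graph and nonempty `X`, the Laplacian of `G.schur X` is indeed the Schur
complement of the Laplacian of `G`. -/
theorem laplacian_schur (G : WeightedGraph V) (hG : G.Connected) {X : Finset V}
    (hX : X.Nonempty) : (G.schur X).laplacian = G.schurMatrix X := by
  have hu := G.isUnit_det_submatrix hG hX
  have hrow : ∀ v, ∑ u, G.laplacian v u = 0 := by
    intro v
    have := G.laplacian_mulVec (fun _ => 1) v
    simpa [Matrix.mulVec, dotProduct] using this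
  have hsplit : ∀ v, ∑ u : {u // u ∈ X}, G.laplacian v u.1 +
      ∑ u : {u // u ∉ X}, G.laplacian v u.1 = 0 := by
    intro v
    rw [← hrow v, ← Fintype.sum_subtype_add_sum_subtype (fun v => v ∈ X)]
    congr 1
    exact Finset.sum_congr (by ext; simp) fun _ _ => rfl
  have hone : G.schurMatrix X *ᵥ (fun _ => 1) = 0 := by
    have e1 : G.laplacian.submatrix (fun v : {v // v ∉ X} => v.1) (fun v : {v // v ∈ X} => v.1) *ᵥ
        (fun _ => 1) = -(G.laplacian.submatrix (fun v : {v // v ∉ X} => v.1)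
          (fun v : {v // v ∉ X} => v.1) *ᵥ (fun _ => 1)) := by
      ext v
      have := hsplit v.1
      simp only [Matrix.mulVec, dotProduct, Matrix.submatrix_apply, mul_one, Pi.neg_apply]
      linarith
    rw [schurMatrix, Matrix.sub_mulVec, ← Matrix.mulVec_mulVec, e1, Matrix.mulVec_neg,
      Matrix.mulVec_mulVec, Matrix.mul_assoc, Matrix.nonsing_inv_mul _ hu, Matrix.mul_one]
    ext v
    have := hsplit v.1
    simp only [Matrix.mulVec, dotProduct, Matrix.submatrix_apply, mul_one, Pi.sub_apply,
      Pi.neg_apply, Pi.zero_apply]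
    linarith
  ext u v
  by_cases h : u = v
  · subst h
    have h1 : ∑ w, G.schurMatrix X u w = 0 := by
      simpa [Matrix.mulVec, dotProduct] using congrFun hone u
    have h2 : (G.schur X).laplacian u u = ∑ w, (if u = w then 0 else -G.schurMatrix X u w) := by
      simp [laplacian, deg, schur]
    have h3 : ∀ w, (if u = w then 0 else -G.schurMatrix X u w) =
        (if u = w then G.schurMatrix X u u else 0) - G.schurMatrix X u w := by
      intro w
      split_ifs with e
      · subst e; ring
      · ring
    rw [h2, Finset.sum_congr rfl fun w _ => h3 w, Finset.sum_sub_distrib, h1]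
    simp
  · simp [laplacian, schur, h]

/-- The fractional conductance of the cut between `A` and `B` in the Schur complement of `G`
onto `A ∪ B`. -/
def schurConductance (G : WeightedGraph V) (A B : Finset V) : ℝ :=
  (G.schur (A ∪ B)).cut (A.subtype (· ∈ A ∪ B)) (B.subtype (· ∈ A ∪ B)) /
    min ((G.schur (A ∪ B)).vol (A.subtype (· ∈ A ∪ B)))
      ((G.schur (A ∪ B)).vol (B.subtype (· ∈ A ∪ B)))

/-- The values of `schurConductance` over all pairs of disjoint nonempty vertex sets. -/
def schurConductances (G : WeightedGraph V) : Set ℝ :=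
  {r | ∃ A B : Finset V, A.Nonempty ∧ B.Nonempty ∧ Disjoint A B ∧ r = G.schurConductance A B}

/-- The Schur complement fractional conductance of `G`: the minimum of `schurConductance A B`
over disjoint nonempty `A`, `B`. -/
def minSchurConductance (G : WeightedGraph V) : ℝ := sInf G.schurConductances

end

end WeightedGraph

/-! Everything rests on Dirichlet's principle: the energy of `g` in `G.schur X` equals the energy of
its harmonic extension and is the least energy of any extension of `g` to `V`
(`exists_harmonic_extension`, `schur_energy_le`). Hence the cut between `A` and `B` in the Schur
complement is the least energy of a function equal to `1` on `A` and `0` on `B`.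

Lower bound: the minimizer, centred at its weighted mean, is a test function for the Poincaré
inequality. Its variance is at least half the smaller volume, and volumes only shrink when vertices
are eliminated.

Upper bound: an eigenvector for the gap `l`, shifted by a weighted median, has a positive or
negative part `f` with Rayleigh quotient at most `l` and support of at most half the volume
(`exists_test_function`). Take `A = {f ≥ t}` and `B = {f < t / 2}`. The linear ramp between the two
levels bounds the Schur cut. Because the levels are a factor `2` apart, averaging over `t ^ 2` gives
ramp energy of order `l * vol A`, not the square root of Cheeger's inequality (`exists_threshold`).
The same `t` makes the boundaries of `A` and `B` small, so both keep at least `vol A / 2` in the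
Schur complement. This needs `l ≤ 1 / 25600`; for larger `l` the bound is trivial since conductances
are at most `1`. -/

namespace WeightedGraph

/-! ### Degrees, volumes and cuts. -/

section Volume

variable {V : Type*}

theorem sum_subtype_union [DecidableEq V] (A X : Finset V) (h : A ⊆ X) (f : V → ℝ) :
    ∑ v ∈ A.subtype (· ∈ X), f v.1 = ∑ v ∈ A, f v := by
  rw [Finset.sum_subtype_of_mem f (fun v hv => h hv)]

theorem cut_comm (G : WeightedGraph V) (A B : Finset V) : G.cut A B = G.cut B A := by
  rw [cut, Finset.sum_comm]
  exact Finset.sum_congr rfl fun u _ => Finset.sum_congr rfl fun v _ => G.symm v u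

variable [Fintype V]

theorem deg_nonneg (G : WeightedGraph V) (v : V) : 0 ≤ G.deg v :=
  Finset.sum_nonneg fun u _ => G.nonneg v u

theorem deg_pos [Nontrivial V] (G : WeightedGraph V) (hG : G.Connected) (v : V) : 0 < G.deg v := by
  obtain ⟨u, hu⟩ := hG.preconnected.exists_adj_of_nontrivial v
  have h1 : 0 < G.c v u := hu
  exact h1.trans_le (Finset.single_le_sum (f := fun u => G.c v u)
    (fun u _ => G.nonneg v u) (Finset.mem_univ u))

theorem cut_le_vol (G : WeightedGraph V) (A B : Finset V) : G.cut A B ≤ G.vol A :=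
  Finset.sum_le_sum fun v _ =>
    Finset.sum_le_sum_of_subset_of_nonneg (Finset.subset_univ _) fun u _ _ => G.nonneg v u

theorem vol_mono (G : WeightedGraph V) {A B : Finset V} (h : A ⊆ B) : G.vol A ≤ G.vol B :=
  Finset.sum_le_sum_of_subset_of_nonneg h fun v _ _ => G.deg_nonneg v

end Volume

/-! ### The Dirichlet energy. -/

section Energy

variable {V : Type*} [Fintype V] [DecidableEq V]

/-- The Dirichlet energy `xᵀ L x`. -/
noncomputable def energy (G : WeightedGraph V) (x : V → ℝ) : ℝ := ∑ v, x v * (G.laplacian *ᵥ x) v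

theorem two_mul_energy (G : WeightedGraph V) (x : V → ℝ) :
    2 * G.energy x = ∑ v, ∑ u, G.c v u * (x v - x u) ^ 2 := by
  rw [energy, sum_mul_laplacian]
  simp only [pow_two]

theorem energy_nonneg (G : WeightedGraph V) (x : V → ℝ) : 0 ≤ G.energy x := by
  have h := G.two_mul_energy x
  have : 0 ≤ ∑ v, ∑ u, G.c v u * (x v - x u) ^ 2 :=
    Finset.sum_nonneg fun v _ => Finset.sum_nonneg fun u _ =>
      mul_nonneg (G.nonneg v u) (sq_nonneg _)
  linarith

theorem eq_of_energy_nonpos (G : WeightedGraph V) (hG : G.Connected) {x : V → ℝ}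
    (h : G.energy x ≤ 0) (u v : V) : x u = x v := by
  have h3 := G.energy_eq_zero x (by rw [← two_mul_energy]; linarith)
  obtain ⟨p⟩ := hG.preconnected u v
  induction p with
  | nil => rfl
  | cons h p ih =>
    rw [← ih]
    have := (mul_eq_zero.mp (h3 _ _)).resolve_left (ne_of_gt h)
    linarith

theorem energy_single (G : WeightedGraph V) (v : V) : G.energy (Pi.single v 1) = G.deg v := by
  simp [energy, Pi.single_apply, laplacian, G.loopless v]

theorem sum_mul_laplacian_comm (G : WeightedGraph V) (x y : V → ℝ) :
    ∑ v, x v * (G.laplacian *ᵥ y) v = ∑ v, y v * (G.laplacian *ᵥ x) v := by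
  have h1 := G.sum_mul_laplacian x y
  have h2 := G.sum_mul_laplacian y x
  have : ∑ v, ∑ u, G.c v u * ((x v - x u) * (y v - y u)) =
      ∑ v, ∑ u, G.c v u * ((y v - y u) * (x v - x u)) := by
    simp only [mul_comm (x _ - x _)]
  linarith

theorem energy_add (G : WeightedGraph V) (x y : V → ℝ) :
    G.energy (x + y) = G.energy x + G.energy y + 2 * ∑ v, y v * (G.laplacian *ᵥ x) v := by
  have h := G.sum_mul_laplacian_comm x y
  simp only [energy, Matrix.mulVec_add, Pi.add_apply, add_mul, mul_add, Finset.sum_add_distrib]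
  linarith

/-- The energy of the indicator function of a vertex set is the weight of its boundary. -/
theorem energy_indicator (G : WeightedGraph V) (A B : Finset V) (hd : Disjoint A B)
    (hu : A ∪ B = Finset.univ) : G.energy (fun v => if v ∈ A then 1 else 0) = G.cut A B := by
  have hB : ∀ v, v ∈ B ↔ v ∉ A := fun v =>
    ⟨fun h h' => Finset.disjoint_left.mp hd h' h, fun h => by
      have := Finset.mem_univ v
      rw [← hu, Finset.mem_union] at this
      exact this.resolve_left h⟩
  have hBf : B = Finset.univ.filter (fun v => v ∉ A) := by ext; simp [hB]
  simp only [energy, laplacian_mulVec, cut, ite_mul, one_mul, zero_mul]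
  rw [← Finset.sum_filter]
  refine Finset.sum_congr (by ext; simp) fun v hv => ?_
  rw [hBf, Finset.sum_filter]
  refine Finset.sum_congr rfl fun u _ => ?_
  have : v ∈ A := by simpa using hv
  by_cases h : u ∈ A <;> simp [this, h]

theorem vol_add_vol_compl (G : WeightedGraph V) (A : Finset V) :
    G.vol A + G.vol Aᶜ = ∑ v, G.deg v :=
  Finset.sum_add_sum_compl A _

end Energy

/-! ### Schur complements and Dirichlet's principle. -/

section Schur

variable {V : Type*} [Fintype V] [DecidableEq V]

/-- Eliminating vertices only adds weight: the correction is a product of two nonpositive blocks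
with the entrywise nonnegative inverse of the eliminated block. -/
theorem le_schur_c (G : WeightedGraph V) (X : Finset V) (u v : {v // v ∈ X}) :
    G.c u.1 v.1 ≤ (G.schur X).c u v := by
  by_cases h : u = v
  · subst h; simp [schur, G.loopless]
  have h1 : G.laplacian u.1 v.1 = -G.c u.1 v.1 := by
    have : u.1 ≠ v.1 := fun e => h (Subtype.ext e)
    simp [laplacian, this]
  have h2 : (G.schur X).c u v = -G.schurMatrix X u v := by simp [schur, h]
  rw [h2]
  simp only [schurMatrix, Matrix.sub_apply, Matrix.mul_apply, Matrix.submatrix_apply, h1]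
  rw [neg_sub, sub_neg_eq_add]
  refine le_add_of_nonneg_left (Finset.sum_nonneg fun j _ => ?_)
  refine mul_nonneg_of_nonpos_of_nonpos (Finset.sum_nonpos fun i _ => ?_) ?_
  · exact mul_nonpos_of_nonpos_of_nonneg
      (G.laplacian_nonpos fun e => i.2 (e ▸ u.2)) (G.inv_submatrix_nonneg X i j)
  · exact G.laplacian_nonpos fun e => j.2 (e ▸ v.2)

/-- The harmonic extension to `V` of a function on `X`. -/
theorem exists_harmonic_extension (G : WeightedGraph V) (hG : G.Connected) {X : Finset V}
    (hX : X.Nonempty) (g : {v // v ∈ X} → ℝ) :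
    ∃ x : V → ℝ, (∀ v : {v // v ∈ X}, x v.1 = g v) ∧ (∀ v ∉ X, (G.laplacian *ᵥ x) v = 0) ∧
      G.energy x = (G.schur X).energy g := by
  have hu := G.isUnit_det_submatrix hG hX
  have hS := G.laplacian_schur hG hX
  set M := G.laplacian.submatrix (fun v : {v // v ∉ X} => v.1) (fun v : {v // v ∉ X} => v.1)
    with hM
  set P := G.laplacian.submatrix (fun v : {v // v ∉ X} => v.1) (fun v : {v // v ∈ X} => v.1)
    with hP
  -- Off `X` the extension solves `M h = -P g`, so that `L x` vanishes there; substituting this `h`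
  -- into the rows of `X` produces the Schur complement.
  set h : {v // v ∉ X} → ℝ := -(M⁻¹ *ᵥ (P *ᵥ g)) with hh
  set x : V → ℝ := fun v => if hv : v ∈ X then g ⟨v, hv⟩ else h ⟨v, hv⟩ with hx
  have hxX : ∀ v : {v // v ∈ X}, x v.1 = g v := fun v => by simp [hx, v.2]
  have hxS : ∀ v : {v // v ∉ X}, x v.1 = h v := fun v => by simp [hx, v.2]
  have hsplit : ∀ f : V → ℝ, ∑ u, f u = ∑ u : {u // u ∈ X}, f u.1 + ∑ u : {u // u ∉ X}, f u.1 := by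
    intro f
    rw [← Fintype.sum_subtype_add_sum_subtype (fun v => v ∈ X)]
    congr 1
    exact Finset.sum_congr (by ext; simp) fun _ _ => rfl
  have hL : ∀ v, (G.laplacian *ᵥ x) v = ∑ u : {u // u ∈ X}, G.laplacian v u.1 * g u +
      ∑ u : {u // u ∉ X}, G.laplacian v u.1 * h u := by
    intro v
    simp only [Matrix.mulVec, dotProduct]
    rw [hsplit]
    simp only [hxX, hxS]
  have hLS : ∀ v : {v // v ∉ X}, (G.laplacian *ᵥ x) v.1 = 0 := by
    intro v
    have e : (P *ᵥ g + M *ᵥ h) v = 0 := by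
      rw [hh, Matrix.mulVec_neg, Matrix.mulVec_mulVec, Matrix.mul_nonsing_inv _ hu,
        Matrix.one_mulVec]
      simp
    rw [hL v.1]
    exact e
  have hLX : ∀ v : {v // v ∈ X}, (G.laplacian *ᵥ x) v.1 = ((G.schur X).laplacian *ᵥ g) v := by
    intro v
    rw [hS, schurMatrix, ← hM, ← hP, Matrix.sub_mulVec, ← Matrix.mulVec_mulVec,
      ← Matrix.mulVec_mulVec, sub_eq_add_neg, ← Matrix.mulVec_neg, hL v.1]
    rfl
  refine ⟨x, hxX, fun v hv => hLS ⟨v, hv⟩, ?_⟩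
  rw [energy, energy, hsplit]
  simp only [hLS, mul_zero, Finset.sum_const_zero, add_zero, hxX, hLX]

/-- Dirichlet's principle: passing to the Schur complement does not increase the energy. -/
theorem schur_energy_le (G : WeightedGraph V) (hG : G.Connected) {X : Finset V}
    (hX : X.Nonempty) (x : V → ℝ) : (G.schur X).energy (fun v => x v.1) ≤ G.energy x := by
  obtain ⟨h, h1, h2, h3⟩ := G.exists_harmonic_extension hG hX (fun v => x v.1)
  -- Orthogonality: `x - h` vanishes on `X` and `L h` vanishes off `X`, so the energies of `h` and
  -- `x - h` add up.
  have h4 : ∑ v, (x - h) v * (G.laplacian *ᵥ h) v = 0 := by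
    refine Finset.sum_eq_zero fun v _ => ?_
    by_cases hv : v ∈ X
    · simp [h1 ⟨v, hv⟩]
    · simp [h2 v hv]
  have h5 := G.energy_add h (x - h)
  rw [add_sub_cancel, h4] at h5
  have := G.energy_nonneg (x - h)
  linarith

/-- A degree is the energy of a point mass, so this is an instance of Dirichlet's principle. -/
theorem schur_deg_le (G : WeightedGraph V) (hG : G.Connected) {X : Finset V}
    (v : {v // v ∈ X}) : (G.schur X).deg v ≤ G.deg v.1 := by
  rw [← energy_single, ← energy_single]
  convert G.schur_energy_le hG ⟨v.1, v.2⟩ (Pi.single v.1 1) using 2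
  ext u
  simp only [Pi.single_apply, Subtype.ext_iff]

/-- The left side is the weight inside `A`, which by `le_schur_c` survives elimination. -/
theorem vol_sub_cut_le_schur_vol (G : WeightedGraph V) {A X : Finset V} (h : A ⊆ X) :
    G.vol A - G.cut A Aᶜ ≤ (G.schur X).vol (A.subtype (· ∈ X)) := by
  have h1 : G.vol A - G.cut A Aᶜ = ∑ v ∈ A, ∑ u ∈ A, G.c v u := by
    rw [vol, cut, ← Finset.sum_sub_distrib]
    refine Finset.sum_congr rfl fun v _ => ?_
    rw [deg, ← Finset.sum_add_sum_compl A]; ring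
  rw [h1, ← sum_subtype_union A X h]
  refine Finset.sum_le_sum fun v _ => ?_
  rw [← sum_subtype_union A X h]
  exact (Finset.sum_le_sum fun u _ => G.le_schur_c X v u).trans
    (Finset.sum_le_sum_of_subset_of_nonneg (Finset.subset_univ _) fun u _ _ =>
      (G.schur X).nonneg v u)

theorem schur_vol_le (G : WeightedGraph V) (hG : G.Connected) {A X : Finset V} (h : A ⊆ X) :
    (G.schur X).vol (A.subtype (· ∈ X)) ≤ G.vol A := by
  rw [vol, vol, ← sum_subtype_union A X h]
  exact Finset.sum_le_sum fun v _ => G.schur_deg_le hG v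

theorem schur_cut_eq_energy (G : WeightedGraph V) {A B : Finset V} (hd : Disjoint A B) :
    (G.schur (A ∪ B)).cut (A.subtype (· ∈ A ∪ B)) (B.subtype (· ∈ A ∪ B)) =
      (G.schur (A ∪ B)).energy (fun v => if v.1 ∈ A then 1 else 0) := by
  rw [← energy_indicator _ (A.subtype (· ∈ A ∪ B)) (B.subtype (· ∈ A ∪ B))]
  · simp
  · rw [Finset.disjoint_left]
    intro v h1 h2
    exact Finset.disjoint_left.mp hd (Finset.mem_subtype.mp h1) (Finset.mem_subtype.mp h2)
  · ext v
    simp [Finset.mem_union.mp v.2]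

/-- The energy of a function that is `1` on `A` and `0` on `B` bounds the cut in the Schur
complement. -/
theorem schur_cut_le_energy (G : WeightedGraph V) (hG : G.Connected) {A B : Finset V}
    (hA : A.Nonempty) (hd : Disjoint A B) (x : V → ℝ) (h1 : ∀ v ∈ A, x v = 1)
    (h0 : ∀ v ∈ B, x v = 0) :
    (G.schur (A ∪ B)).cut (A.subtype (· ∈ A ∪ B)) (B.subtype (· ∈ A ∪ B)) ≤ G.energy x := by
  rw [G.schur_cut_eq_energy hd]
  convert G.schur_energy_le hG (hA.mono Finset.subset_union_left) x using 2
  ext v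
  by_cases hv : v.1 ∈ A
  · simp [hv, h1]
  · have : v.1 ∈ B := (Finset.mem_union.mp v.2).resolve_left hv
    simp [hv, h0 _ this]

theorem exists_energy_eq_schur_cut (G : WeightedGraph V) (hG : G.Connected) {A B : Finset V}
    (hA : A.Nonempty) (hd : Disjoint A B) :
    ∃ x : V → ℝ, (∀ v ∈ A, x v = 1) ∧ (∀ v ∈ B, x v = 0) ∧ G.energy x =
      (G.schur (A ∪ B)).cut (A.subtype (· ∈ A ∪ B)) (B.subtype (· ∈ A ∪ B)) := by
  obtain ⟨x, h1, -, h3⟩ := G.exists_harmonic_extension hG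
    (hA.mono (Finset.subset_union_left (s₂ := B))) (fun v => if v.1 ∈ A then 1 else 0)
  refine ⟨x, fun v hv => ?_, fun v hv => ?_, by rw [h3, G.schur_cut_eq_energy hd]⟩
  · rw [h1 ⟨v, Finset.mem_union_left _ hv⟩]; simp [hv]
  · rw [h1 ⟨v, Finset.mem_union_right _ hv⟩]
    simp [Finset.disjoint_right.mp hd hv]

theorem schur_cut_pos (G : WeightedGraph V) (hG : G.Connected) {A B : Finset V}
    (hA : A.Nonempty) (hB : B.Nonempty) (hd : Disjoint A B) :
    0 < (G.schur (A ∪ B)).cut (A.subtype (· ∈ A ∪ B)) (B.subtype (· ∈ A ∪ B)) := by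
  obtain ⟨x, h1, h0, hE⟩ := G.exists_energy_eq_schur_cut hG hA hd
  rw [← hE]
  by_contra! h
  obtain ⟨a, ha⟩ := hA
  obtain ⟨b, hb⟩ := hB
  have := G.eq_of_energy_nonpos hG h a b
  rw [h1 a ha, h0 b hb] at this
  exact one_ne_zero this

theorem schurConductance_le_one (G : WeightedGraph V) (A B : Finset V) :
    G.schurConductance A B ≤ 1 := by
  refine div_le_one_of_le₀ (le_min (cut_le_vol _ _ _) ?_) (le_min ?_ ?_)
  · rw [cut_comm]; exact cut_le_vol _ _ _
  · exact Finset.sum_nonneg fun v _ => deg_nonneg _ v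
  · exact Finset.sum_nonneg fun v _ => deg_nonneg _ v

end Schur

end WeightedGraph

namespace WeightedGraph

/-! ### The spectral gap, the Poincaré inequality and the lower bound. -/

section Spectral

variable {V : Type*} [Fintype V] [DecidableEq V]

theorem isHermitian_normLaplacian (G : WeightedGraph V) : G.normLaplacian.IsHermitian := by
  simp [Matrix.IsHermitian, normLaplacian, Matrix.mul_assoc,
    Matrix.conjTranspose_eq_transpose_of_trivial, laplacian_symm]

theorem normLaplacian_mulVec (G : WeightedGraph V) (z : V → ℝ) (v : V) :
    (G.normLaplacian *ᵥ z) v =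
      (√(G.deg v))⁻¹ * (G.laplacian *ᵥ fun u => (√(G.deg u))⁻¹ * z u) v := by
  rw [normLaplacian, ← Matrix.mulVec_mulVec, ← Matrix.mulVec_mulVec, Matrix.mulVec_diagonal]
  congr 2
  ext u
  rw [Matrix.mulVec_diagonal]

theorem laplacian_mulVec_of_eigenvector [Nontrivial V] (G : WeightedGraph V) (hG : G.Connected)
    {z : V → ℝ} {μ : ℝ} (hz : G.normLaplacian *ᵥ z = μ • z) (v : V) :
    (G.laplacian *ᵥ fun u => (√(G.deg u))⁻¹ * z u) v = μ * G.deg v * ((√(G.deg v))⁻¹ * z v) := by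
  have h1 := congrFun hz v
  rw [normLaplacian_mulVec, Pi.smul_apply, smul_eq_mul] at h1
  have h2 : 0 < √(G.deg v) := Real.sqrt_pos.mpr (G.deg_pos hG v)
  have h3 := Real.mul_self_sqrt (G.deg_nonneg v)
  field_simp at h1 ⊢
  rw [h1]
  linear_combination (μ * z v) * h3

theorem sum_laplacian_mulVec (G : WeightedGraph V) (y : V → ℝ) :
    ∑ v, (G.laplacian *ᵥ y) v = 0 := by
  have := G.sum_mul_laplacian (fun _ => 1) y
  simpa using this

/-- Each nonzero eigenvalue of the normalized Laplacian has a generalized eigenvector of the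
pair `(L, D)` that is orthogonal to the constants. -/
theorem exists_eigenvector [Nontrivial V] (G : WeightedGraph V) (hG : G.Connected) {μ : ℝ}
    (hμ : μ ∈ G.nonzeroEigenvalues) : ∃ y : V → ℝ, y ≠ 0 ∧ ∑ v, G.deg v * y v = 0 ∧
      G.energy y = μ * ∑ v, G.deg v * y v ^ 2 := by
  obtain ⟨hμ0, hμ⟩ := hμ
  obtain ⟨z, hz, hz0⟩ := hμ.exists_hasEigenvector
  rw [Module.End.mem_eigenspace_iff, Matrix.toLin'_apply] at hz
  have hL := G.laplacian_mulVec_of_eigenvector hG hz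
  refine ⟨fun u => (√(G.deg u))⁻¹ * z u, fun h => hz0 ?_, ?_, ?_⟩
  · ext v
    have h2 : 0 < √(G.deg v) := Real.sqrt_pos.mpr (G.deg_pos hG v)
    have := congrFun h v
    simpa [h2.ne'] using this
  -- The entries of `L y` sum to zero, and `L y = μ D y` with `μ ≠ 0`.
  · have h1 := G.sum_laplacian_mulVec fun u => (√(G.deg u))⁻¹ * z u
    simp only [hL, mul_assoc, ← Finset.mul_sum] at h1
    exact (mul_eq_zero.mp h1).resolve_left hμ0
  · rw [energy, Finset.mul_sum]
    refine Finset.sum_congr rfl fun v _ => ?_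
    rw [hL]; ring

theorem eigenvalue_pos [Nontrivial V] (G : WeightedGraph V) (hG : G.Connected) {μ : ℝ}
    (hμ : μ ∈ G.nonzeroEigenvalues) : 0 < μ := by
  obtain ⟨y, hy0, -, hE⟩ := G.exists_eigenvector hG hμ
  obtain ⟨v, hv⟩ := Function.ne_iff.mp hy0
  have h1 : 0 < ∑ v, G.deg v * y v ^ 2 :=
    Finset.sum_pos' (fun v _ => mul_nonneg (G.deg_nonneg v) (sq_nonneg _))
      ⟨v, Finset.mem_univ v, mul_pos (G.deg_pos hG v) (sq_pos_of_ne_zero hv)⟩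
  have h2 := G.energy_nonneg y
  rw [hE] at h2
  exact lt_of_le_of_ne (nonneg_of_mul_nonneg_left h2 h1) (Ne.symm hμ.1)

theorem finite_nonzeroEigenvalues (G : WeightedGraph V) : G.nonzeroEigenvalues.Finite :=
  (Module.End.finite_hasEigenvalue (Matrix.toLin' G.normLaplacian)).subset fun _ h => h.2

/-- Spectral decomposition of the energy. The coefficients of a vector with respect to the
eigenvectors of eigenvalue `0` vanish when it is orthogonal to the constants. -/
theorem exists_energy_decomposition [Nontrivial V] (G : WeightedGraph V) (hG : G.Connected) :
    ∃ μ : V → ℝ, (∀ i, μ i ≠ 0 → μ i ∈ G.nonzeroEigenvalues) ∧ ∀ y : V → ℝ, ∃ a : V → ℝ,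
      G.energy y = ∑ i, μ i * a i ^ 2 ∧ ∑ v, G.deg v * y v ^ 2 = ∑ i, a i ^ 2 ∧
        (∑ v, G.deg v * y v = 0 → ∀ i, μ i = 0 → a i = 0) := by
  have hN := G.isHermitian_normLaplacian
  set b := hN.eigenvectorBasis with hb
  have hs : ∀ v, 0 < √(G.deg v) := fun v => Real.sqrt_pos.mpr (G.deg_pos hG v)
  have hss : ∀ v, √(G.deg v) * √(G.deg v) = G.deg v := fun v =>
    Real.mul_self_sqrt (G.deg_nonneg v)
  have hev : ∀ i, G.normLaplacian *ᵥ (b i).ofLp = hN.eigenvalues i • (b i).ofLp :=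
    fun i => hN.mulVec_eigenvectorBasis i
  refine ⟨hN.eigenvalues, fun i hi => ⟨hi, ?_⟩, fun y => ?_⟩
  · refine Module.End.hasEigenvalue_of_hasEigenvector (x := (b i).ofLp) ⟨?_, fun h => ?_⟩
    · rw [Module.End.mem_eigenspace_iff, Matrix.toLin'_apply, hev]
    · exact b.orthonormal.ne_zero i (by ext v; exact congrFun h v)
  -- Substituting `z = D^{1/2} y` turns the degree-weighted norm into the Euclidean one; the
  -- coefficients `a i` are the coordinates of `z` in the eigenbasis.
  set z : V → ℝ := fun v => √(G.deg v) * y v with hz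
  set Z : EuclideanSpace ℝ V := WithLp.toLp 2 z with hZ
  have hinner : ∀ (i : V) (w : V → ℝ), inner ℝ (b i) (WithLp.toLp 2 w) = (b i).ofLp ⬝ᵥ w := by
    intro i w
    simp [PiLp.inner_apply, dotProduct, mul_comm]
  have hpars : ∀ w : V → ℝ, z ⬝ᵥ w = ∑ i, ((b i).ofLp ⬝ᵥ z) * ((b i).ofLp ⬝ᵥ w) := by
    intro w
    have h := b.sum_inner_mul_inner Z (WithLp.toLp 2 w)
    simp only [hinner] at h
    rw [show z ⬝ᵥ w = inner ℝ Z (WithLp.toLp 2 w) by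
      simp [hZ, PiLp.inner_apply, dotProduct, mul_comm], ← h]
    refine Finset.sum_congr rfl fun i _ => ?_
    rw [real_inner_comm, hZ, hinner]
  have hzy : (fun u => (√(G.deg u))⁻¹ * z u) = y := by
    ext u
    simp [hz, (hs u).ne']
  refine ⟨fun i => (b i).ofLp ⬝ᵥ z, ?_, ?_, fun hy i hi => ?_⟩
  · have h1 : G.energy y = z ⬝ᵥ (G.normLaplacian *ᵥ z) := by
      rw [energy, dotProduct]
      refine Finset.sum_congr rfl fun v _ => ?_
      rw [normLaplacian_mulVec, hzy, hz]
      field_simp [(hs v).ne']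
    rw [h1, hpars]
    refine Finset.sum_congr rfl fun i _ => ?_
    have h2 : (b i).ofLp ⬝ᵥ (G.normLaplacian *ᵥ z) = hN.eigenvalues i * ((b i).ofLp ⬝ᵥ z) := by
      rw [Matrix.dotProduct_mulVec, ← Matrix.mulVec_transpose,
        ← Matrix.conjTranspose_eq_transpose_of_trivial, hN.eq, hev, smul_dotProduct, smul_eq_mul]
    rw [h2]; ring
  · have h1 := hpars z
    have h2 : z ⬝ᵥ z = ∑ v, G.deg v * y v ^ 2 := by
      rw [dotProduct]
      refine Finset.sum_congr rfl fun v _ => ?_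
      rw [hz, ← hss v]; ring
    rw [← h2, h1]
    exact Finset.sum_congr rfl fun i _ => (pow_two _).symm
  -- For eigenvalue `0` the vector `D^{-1/2} b i` has zero energy, hence is constant by
  -- connectedness. The coefficient is then a multiple of `∑ v, G.deg v * y v`.
  · have hL := G.laplacian_mulVec_of_eigenvector hG (hev i)
    rw [hi] at hL
    set w : V → ℝ := fun u => (√(G.deg u))⁻¹ * (b i).ofLp u with hw
    have hE : G.energy w ≤ 0 := by simp [energy, hL]
    have hconst := G.eq_of_energy_nonpos hG hE
    obtain ⟨v₀⟩ : Nonempty V := inferInstance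
    have hbi : ∀ v, (b i).ofLp v = √(G.deg v) * w v₀ := by
      intro v
      rw [← hconst v v₀, hw]
      simp [(hs v).ne']
    have : (b i).ofLp ⬝ᵥ z = w v₀ * ∑ v, G.deg v * y v := by
      rw [dotProduct, Finset.mul_sum]
      refine Finset.sum_congr rfl fun v _ => ?_
      rw [hbi, hz]
      linear_combination (w v₀ * y v) * hss v
    simp only [this, hy, mul_zero]

/-- If all eigenvalues were zero the energy would vanish identically, but a point mass has energy
`G.deg v > 0`. -/
theorem nonempty_nonzeroEigenvalues [Nontrivial V] (G : WeightedGraph V) (hG : G.Connected) :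
    G.nonzeroEigenvalues.Nonempty := by
  obtain ⟨μ, hμ, hdec⟩ := G.exists_energy_decomposition hG
  by_contra h
  rw [Set.not_nonempty_iff_eq_empty] at h
  obtain ⟨v⟩ : Nonempty V := inferInstance
  obtain ⟨a, ha, -⟩ := hdec (Pi.single v 1)
  have h0 : ∀ i, μ i = 0 := fun i => by
    by_contra hi
    simpa [h] using hμ i hi
  rw [energy_single] at ha
  have := G.deg_pos hG v
  simp [h0] at ha
  linarith

theorem isLeast_spectralGap [Nontrivial V] (G : WeightedGraph V) (hG : G.Connected) :
    IsLeast G.nonzeroEigenvalues G.spectralGap :=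
  ⟨(G.nonempty_nonzeroEigenvalues hG).csInf_mem G.finite_nonzeroEigenvalues,
    fun _ h => csInf_le G.finite_nonzeroEigenvalues.bddBelow h⟩

/-- The Poincaré inequality. -/
theorem spectralGap_mul_le_energy [Nontrivial V] (G : WeightedGraph V) (hG : G.Connected)
    {y : V → ℝ} (hy : ∑ v, G.deg v * y v = 0) :
    G.spectralGap * ∑ v, G.deg v * y v ^ 2 ≤ G.energy y := by
  obtain ⟨μ, hμ, hdec⟩ := G.exists_energy_decomposition hG
  obtain ⟨a, h1, h2, h3⟩ := hdec y
  rw [h1, h2, Finset.mul_sum]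
  refine Finset.sum_le_sum fun i _ => ?_
  by_cases hi : μ i = 0
  · simp [h3 hy i hi]
  · exact mul_le_mul_of_nonneg_right ((G.isLeast_spectralGap hG).2 (hμ i hi)) (sq_nonneg _)

theorem energy_sub_const (G : WeightedGraph V) (x : V → ℝ) (t : ℝ) :
    G.energy (fun v => x v - t) = G.energy x := by
  have h1 := G.two_mul_energy x
  have h2 := G.two_mul_energy (fun v => x v - t)
  simp only [sub_sub_sub_cancel_right] at h2
  linarith

theorem spectralGap_div_two_le_schurConductance [Nontrivial V] (G : WeightedGraph V)
    (hG : G.Connected) {A B : Finset V} (hA : A.Nonempty) (hB : B.Nonempty)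
    (hd : Disjoint A B) : G.spectralGap / 2 ≤ G.schurConductance A B := by
  obtain ⟨x, h1, h0, hE⟩ := G.exists_energy_eq_schur_cut hG hA hd
  have hpos := G.schur_cut_pos hG hA hB hd
  have hvA := cut_le_vol (G.schur (A ∪ B)) (A.subtype (· ∈ A ∪ B)) (B.subtype (· ∈ A ∪ B))
  have hvB := cut_le_vol (G.schur (A ∪ B)) (B.subtype (· ∈ A ∪ B)) (A.subtype (· ∈ A ∪ B))
  rw [cut_comm] at hvB
  have hA' := G.schur_vol_le hG (Finset.subset_union_left (s₁ := A) (s₂ := B))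
  have hB' := G.schur_vol_le hG (Finset.subset_union_right (s₁ := A) (s₂ := B))
  rw [schurConductance]
  set C := (G.schur (A ∪ B)).cut (A.subtype (· ∈ A ∪ B)) (B.subtype (· ∈ A ∪ B))
  set p := (G.schur (A ∪ B)).vol (A.subtype (· ∈ A ∪ B))
  set q := (G.schur (A ∪ B)).vol (B.subtype (· ∈ A ∪ B))
  have hgap := G.eigenvalue_pos hG (G.isLeast_spectralGap hG).1
  have hvol : 0 < ∑ v, G.deg v := Finset.sum_pos (fun v _ => G.deg_pos hG v) Finset.univ_nonempty
  set t := (∑ v, G.deg v * x v) / ∑ v, G.deg v with ht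
  have hy : ∑ v, G.deg v * (x v - t) = 0 := by
    simp only [mul_sub, Finset.sum_sub_distrib, ← Finset.sum_mul]
    rw [ht]; field_simp; ring
  have hP := G.spectralGap_mul_le_energy hG hy
  rw [energy_sub_const, hE] at hP
  have hvar : G.vol A * (1 - t) ^ 2 + G.vol B * t ^ 2 ≤ ∑ v, G.deg v * (x v - t) ^ 2 := by
    have e1 : G.vol A * (1 - t) ^ 2 = ∑ v ∈ A, G.deg v * (x v - t) ^ 2 := by
      rw [vol, Finset.sum_mul]
      exact Finset.sum_congr rfl fun v hv => by rw [h1 v hv]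
    have e2 : G.vol B * t ^ 2 = ∑ v ∈ B, G.deg v * (x v - t) ^ 2 := by
      rw [vol, Finset.sum_mul]
      exact Finset.sum_congr rfl fun v hv => by rw [h0 v hv]; ring
    rw [e1, e2, ← Finset.sum_union hd]
    exact Finset.sum_le_sum_of_subset_of_nonneg (Finset.subset_univ _) fun v _ _ =>
      mul_nonneg (G.deg_nonneg v) (sq_nonneg _)
  have hmin : min p q / 2 ≤ ∑ v, G.deg v * (x v - t) ^ 2 := by
    refine le_trans ?_ hvar
    have hm0 : 0 < min p q := lt_min (hpos.trans_le hvA) (hpos.trans_le hvB)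
    have m1 := mul_le_mul_of_nonneg_right ((min_le_left p q).trans hA') (sq_nonneg (1 - t))
    have m2 := mul_le_mul_of_nonneg_right ((min_le_right p q).trans hB') (sq_nonneg t)
    -- The factor `1 / 2` is the minimum of `(1 - t) ^ 2 + t ^ 2`, attained where `2 * t - 1 = 0`.
    nlinarith [mul_nonneg hm0.le (sq_nonneg (2 * t - 1))]
  rw [le_div_iff₀ (lt_min (hpos.trans_le hvA) (hpos.trans_le hvB))]
  have := mul_le_mul_of_nonneg_left hmin hgap.le
  linarith

theorem isLeast_minSchurConductance [Nontrivial V] (G : WeightedGraph V) :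
    IsLeast G.schurConductances G.minSchurConductance := by
  have hfin : G.schurConductances.Finite := by
    refine (Set.finite_range fun p : Finset V × Finset V => G.schurConductance p.1 p.2).subset ?_
    rintro r ⟨A, B, -, -, -, rfl⟩
    exact ⟨(A, B), rfl⟩
  have hne : G.schurConductances.Nonempty := by
    obtain ⟨a, b, hab⟩ := exists_pair_ne V
    exact ⟨_, {a}, {b}, by simp, by simp, by simpa using hab, rfl⟩
  exact ⟨hne.csInf_mem hfin, fun _ h => csInf_le hfin.bddBelow h⟩

end Spectral

end WeightedGraph

/-! ### Choosing a threshold by averaging. -/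

/-- If a combination of lengths of intervals is positive, then the same combination of their
indicator functions is positive at some point. -/
theorem exists_pos_sum_indicator_Ioc {ι : Type*} [Fintype ι] (w a b : ι → ℝ) (ha : ∀ i, 0 ≤ a i)
    (h : 0 < ∑ i, w i * max (b i - a i) 0) :
    ∃ τ : ℝ, 0 < τ ∧ 0 < ∑ i, w i * (if a i < τ ∧ τ ≤ b i then 1 else 0) := by
  have hind : ∀ i τ, (if a i < τ ∧ τ ≤ b i then (1 : ℝ) else 0) =
      (Set.Ioc (a i) (b i)).indicator 1 τ := by
    intro i τ
    simp [Set.indicator_apply]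
  by_contra! hcon
  -- For `τ ≤ 0` no interval contains `τ`, since the left ends are nonnegative; so the sum is
  -- nonpositive everywhere, and so is its integral.
  have hle : ∀ τ, ∑ i, w i * (Set.Ioc (a i) (b i)).indicator (1 : ℝ → ℝ) τ ≤ 0 := by
    intro τ
    rcases lt_or_ge 0 τ with hτ | hτ
    · simpa only [hind] using hcon τ hτ
    · refine (Finset.sum_eq_zero fun i _ => ?_).le
      simp [(hτ.trans (ha i)).not_gt]
  have hint : ∫ τ, ∑ i, w i * (Set.Ioc (a i) (b i)).indicator (1 : ℝ → ℝ) τ =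
      ∑ i, w i * max (b i - a i) 0 := by
    rw [MeasureTheory.integral_finsetSum]
    · refine Finset.sum_congr rfl fun i _ => ?_
      rw [MeasureTheory.integral_const_mul, MeasureTheory.integral_indicator_one measurableSet_Ioc,
        Real.volume_real_Ioc]
    · intro i _
      refine MeasureTheory.Integrable.const_mul ?_ _
      rw [MeasureTheory.integrable_indicator_iff measurableSet_Ioc]
      exact MeasureTheory.integrableOn_const (by simp)
  have := MeasureTheory.integral_nonpos (μ := MeasureTheory.volume) hle
  linarith

namespace WeightedGraph

/-! ### The ramp function and its pointwise bounds. -/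

section Truncation

/-- The piecewise linear function that is `0` up to `t / 2` and `1` from `t` on. -/
noncomputable def ramp (t s : ℝ) : ℝ := max 0 (min 1 (2 * s / t - 1))

/-- The height of a step function of `t ^ 2` that dominates `(ramp t q - ramp t p) ^ 2`. -/
noncomputable def rampHeight (p q : ℝ) : ℝ :=
  if p < q then (if 2 * p ≤ q then 1 else 4 * (q - p) ^ 2 / p ^ 2) else 0

/-- The left end of the step of height `rampHeight p q`, whose right end is `4 * q ^ 2`. -/
noncomputable def rampStart (p q : ℝ) : ℝ := if 2 * p ≤ q then 0 else p ^ 2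

theorem rampHeight_nonneg (p q : ℝ) : 0 ≤ rampHeight p q := by
  unfold rampHeight; split_ifs <;> positivity

theorem rampStart_nonneg (p q : ℝ) : 0 ≤ rampStart p q := by
  unfold rampStart; split_ifs <;> positivity

/-- Height times length of the step, which bounds its integral over `t ^ 2`. If `2 * p ≤ q`, then `q
≤ 2 * (q - p)`; otherwise `q < 2 * p` bounds the length by `15 * p ^ 2`, whence `60 = 4 * 15`. -/
theorem rampHeight_mul_le {p q : ℝ} (hp : 0 ≤ p) :
    rampHeight p q * max (4 * q ^ 2 - rampStart p q) 0 ≤ 60 * (q - p) ^ 2 := by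
  unfold rampHeight rampStart
  split_ifs with h1 h2
  · rw [one_mul, sub_zero, max_eq_left (by positivity)]
    nlinarith
  · have hp' : 0 < p := by linarith
    have h3 : max (4 * q ^ 2 - p ^ 2) 0 ≤ 15 * p ^ 2 := by
      refine max_le ?_ (by positivity)
      nlinarith
    calc 4 * (q - p) ^ 2 / p ^ 2 * max (4 * q ^ 2 - p ^ 2) 0
        ≤ 4 * (q - p) ^ 2 / p ^ 2 * (15 * p ^ 2) := by gcongr
      _ = 60 * (q - p) ^ 2 := by field_simp; ring
  · rw [zero_mul]; positivity
  · rw [zero_mul]; positivity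

theorem ramp_nonneg (t s : ℝ) : 0 ≤ ramp t s := le_max_left _ _

theorem ramp_le_one (t s : ℝ) : ramp t s ≤ 1 := max_le zero_le_one (min_le_left _ _)

theorem ramp_eq_one {t s : ℝ} (ht : 0 < t) (h : t ≤ s) : ramp t s = 1 := by
  have : 1 ≤ 2 * s / t - 1 := by
    have : 2 ≤ 2 * s / t := by rw [le_div_iff₀ ht]; linarith
    linarith
  simp [ramp, this]

theorem ramp_eq_zero {t s : ℝ} (ht : 0 < t) (h : s < t / 2) : ramp t s = 0 := by
  have : 2 * s / t - 1 ≤ 0 := by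
    have : 2 * s / t ≤ 1 := by rw [div_le_one ht]; linarith
    linarith
  exact max_eq_left ((min_le_right _ _).trans this)

theorem abs_ramp_sub_le {t : ℝ} (ht : 0 < t) (p q : ℝ) :
    |ramp t q - ramp t p| ≤ 2 * |q - p| / t := by
  have h1 : |ramp t q - ramp t p| ≤ |(2 * q / t - 1) - (2 * p / t - 1)| := by
    unfold ramp
    refine (abs_max_sub_max_le_max _ _ _ _).trans ?_
    rw [sub_self, abs_zero, max_eq_right (abs_nonneg _)]
    refine (abs_min_sub_min_le_max _ _ _ _).trans ?_
    rw [sub_self, abs_zero, max_eq_right (abs_nonneg _)]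
  refine h1.trans_eq ?_
  rw [show (2 * q / t - 1) - (2 * p / t - 1) = 2 * (q - p) / t by ring, abs_div, abs_mul,
    abs_of_pos ht, abs_two]

/-- The ramp is constant below `t / 2` and above `t`, so a difference forces `t ≤ 2 * q`, and also
`p < t`. For distant `p` and `q` the trivial bound `1` is enough; for close ones the slope `2 / t`
is at most `2 / p`. -/
theorem sq_ramp_sub_le_of_lt {t p q : ℝ} (ht : 0 < t) (hp : 0 ≤ p) (hpq : p < q) :
    (ramp t q - ramp t p) ^ 2 ≤
      rampHeight p q * (if rampStart p q < t ^ 2 ∧ t ^ 2 ≤ 4 * q ^ 2 then 1 else 0) := by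
  have hR : 0 ≤ rampHeight p q * (if rampStart p q < t ^ 2 ∧ t ^ 2 ≤ 4 * q ^ 2 then 1 else 0) :=
    mul_nonneg (rampHeight_nonneg _ _) (by split_ifs <;> norm_num)
  by_cases hq : t ≤ 2 * q
  swap
  · rw [ramp_eq_zero ht (by linarith : q < t / 2), ramp_eq_zero ht (by linarith : p < t / 2)]
    simpa using hR
  have hq2 : t ^ 2 ≤ 4 * q ^ 2 := by nlinarith
  by_cases h2 : 2 * p ≤ q
  · have h3 : (0 : ℝ) < t ^ 2 := by positivity
    simp only [rampHeight, rampStart, hpq, h2, h3, hq2, and_self, if_true, mul_one]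
    have := ramp_nonneg t q
    have := ramp_nonneg t p
    have := ramp_le_one t q
    have := ramp_le_one t p
    nlinarith
  · have hp' : 0 < p := by linarith
    by_cases h3 : t ≤ p
    · rw [ramp_eq_one ht (by linarith : t ≤ q), ramp_eq_one ht h3]
      simpa using hR
    · have h4 : p ^ 2 < t ^ 2 := by nlinarith
      simp only [rampHeight, rampStart, hpq, h2, h4, hq2, and_self, if_true, if_false, mul_one]
      calc (ramp t q - ramp t p) ^ 2 = |ramp t q - ramp t p| ^ 2 := (sq_abs _).symm
        _ ≤ (2 * |q - p| / t) ^ 2 := by gcongr; exact abs_ramp_sub_le ht p q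
        _ = 4 * (q - p) ^ 2 / t ^ 2 := by rw [div_pow, mul_pow, sq_abs]; norm_num
        _ ≤ 4 * (q - p) ^ 2 / p ^ 2 := by gcongr

theorem sq_ramp_sub_le {t p q : ℝ} (ht : 0 < t) (hp : 0 ≤ p) (hq : 0 ≤ q) :
    (ramp t q - ramp t p) ^ 2 ≤
      rampHeight p q * (if rampStart p q < t ^ 2 ∧ t ^ 2 ≤ 4 * q ^ 2 then 1 else 0) +
      rampHeight q p * (if rampStart q p < t ^ 2 ∧ t ^ 2 ≤ 4 * p ^ 2 then 1 else 0) := by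
  have hR : ∀ p q : ℝ,
      0 ≤ rampHeight p q * (if rampStart p q < t ^ 2 ∧ t ^ 2 ≤ 4 * q ^ 2 then (1 : ℝ) else 0) :=
    fun p q => mul_nonneg (rampHeight_nonneg _ _) (by split_ifs <;> norm_num)
  rcases lt_trichotomy p q with h | h | h
  · exact (sq_ramp_sub_le_of_lt ht hp h).trans (le_add_of_nonneg_right (hR _ _))
  · subst h
    simpa using add_nonneg (hR p p) (hR p p)
  · have := sq_ramp_sub_le_of_lt ht hq h
    rw [← neg_sub, neg_sq]
    exact this.trans (le_add_of_nonneg_left (hR _ _))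

end Truncation

/-! ### The sweep over level sets. -/

section Sweep

variable {V : Type*} [Fintype V]

theorem cut_eq_sum (G : WeightedGraph V) (P Q : V → Prop) [DecidablePred P] [DecidablePred Q] :
    G.cut {v | P v} {v | Q v} = ∑ u, ∑ v, G.c u v * (if P u ∧ Q v then 1 else 0) := by
  rw [cut, Finset.sum_filter]
  refine Finset.sum_congr rfl fun u _ => ?_
  by_cases h : P u <;> simp [h, Finset.sum_filter]

theorem sum_c_mul_add (G : WeightedGraph V) (h : V → ℝ) :
    ∑ u, ∑ v, G.c u v * (h v + h u) = 2 * ∑ v, G.deg v * h v := by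
  have h1 : ∑ u, ∑ v, G.c u v * h u = ∑ v, G.deg v * h v := by
    simp only [deg, Finset.sum_mul]
  have h2 : ∑ u, ∑ v, G.c u v * h v = ∑ v, G.deg v * h v := by
    rw [← h1, Finset.sum_comm]
    exact Finset.sum_congr rfl fun u _ => Finset.sum_congr rfl fun v _ => by rw [G.symm u v]
  simp only [mul_add, Finset.sum_add_distrib, h1, h2]
  ring

variable [DecidableEq V]

theorem sum_c_sq_sub (G : WeightedGraph V) (f : V → ℝ) :
    ∑ u, ∑ v, G.c u v * (f v - f u) ^ 2 = 2 * G.energy f := by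
  rw [two_mul_energy]
  exact Finset.sum_congr rfl fun u _ => Finset.sum_congr rfl fun v _ => by ring

/-- The left side is the integral over `τ` of the boundary weight of `{f ^ 2 ≥ τ}`. Factor the
difference of squares and apply the weighted inequality `a * b ≤ 80 * a ^ 2 + b ^ 2 / 320`; the
weight keeps the multiple of the mass small. -/
theorem sum_c_max_sq_sub_le (G : WeightedGraph V) (f : V → ℝ) :
    ∑ u, ∑ v, G.c u v * max (f v ^ 2 - f u ^ 2) 0 ≤
      160 * G.energy f + 1 / 80 * ∑ v, G.deg v * f v ^ 2 := by
  have h1 : ∑ u, ∑ v, G.c u v * max (f v ^ 2 - f u ^ 2) 0 ≤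
      ∑ u, ∑ v, (80 * (G.c u v * (f v - f u) ^ 2) +
        1 / 160 * (G.c u v * (f v ^ 2 + f u ^ 2))) := by
    refine Finset.sum_le_sum fun u _ => Finset.sum_le_sum fun v _ => ?_
    have : max (f v ^ 2 - f u ^ 2) 0 ≤ 80 * (f v - f u) ^ 2 + 1 / 160 * (f v ^ 2 + f u ^ 2) := by
      refine max_le ?_ (by positivity)
      nlinarith [sq_nonneg (160 * (f v - f u) - (f v + f u)), sq_nonneg (f v - f u)]
    have := mul_le_mul_of_nonneg_left this (G.nonneg u v)
    linarith
  have h2 := G.sum_c_sq_sub f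
  have h3 := G.sum_c_mul_add (fun v => f v ^ 2)
  simp only [Finset.sum_add_distrib, ← Finset.mul_sum] at h1
  rw [h2, h3] at h1
  linarith

theorem energy_ramp_le (G : WeightedGraph V) {f : V → ℝ} (hf : ∀ v, 0 ≤ f v) {t : ℝ}
    (ht : 0 < t) : G.energy (fun v => ramp t (f v)) ≤ ∑ u, ∑ v, G.c u v *
      (rampHeight (f u) (f v) *
        (if rampStart (f u) (f v) < t ^ 2 ∧ t ^ 2 ≤ 4 * f v ^ 2 then 1 else 0)) := by
  set K : V → V → ℝ := fun u v => rampHeight (f u) (f v) *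
    (if rampStart (f u) (f v) < t ^ 2 ∧ t ^ 2 ≤ 4 * f v ^ 2 then 1 else 0) with hK
  have h1 : ∑ u, ∑ v, G.c u v * (ramp t (f v) - ramp t (f u)) ^ 2 ≤
      ∑ u, ∑ v, (G.c u v * K u v + G.c u v * K v u) := by
    refine Finset.sum_le_sum fun u _ => Finset.sum_le_sum fun v _ => ?_
    rw [← mul_add]
    exact mul_le_mul_of_nonneg_left (sq_ramp_sub_le ht (hf u) (hf v)) (G.nonneg u v)
  have h2 : ∑ u, ∑ v, G.c u v * K v u = ∑ u, ∑ v, G.c u v * K u v := by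
    rw [Finset.sum_comm]
    exact Finset.sum_congr rfl fun u _ => Finset.sum_congr rfl fun v _ => by rw [G.symm u v]
  simp only [Finset.sum_add_distrib] at h1
  rw [h2, G.sum_c_sq_sub fun v => ramp t (f v)] at h1
  linarith

/-- A sweep over the level sets of a nonnegative function with small Rayleigh quotient. -/
theorem exists_threshold (G : WeightedGraph V) {f : V → ℝ} (hf : ∀ v, 0 ≤ f v) {l : ℝ}
    (hl : 0 < l) (hl' : l ≤ 1 / 25600) (hM : 0 < ∑ v, G.deg v * f v ^ 2)
    (hE : G.energy f ≤ l * ∑ v, G.deg v * f v ^ 2) :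
    ∃ t : ℝ, 0 < t ∧ 0 < G.vol {v | t ≤ f v} ∧
      2 * G.cut {v | f v < t} {v | t ≤ f v} ≤ G.vol {v | t ≤ f v} ∧
      2 * G.cut {v | f v < t / 2} {v | t / 2 ≤ f v} ≤ G.vol {v | t ≤ f v} ∧
      G.energy (fun v => ramp t (f v)) ≤ 480 * l * G.vol {v | t ≤ f v} := by
  set M := ∑ v, G.deg v * f v ^ 2 with hMdef
  have hlM : l * M ≤ 1 / 25600 * M := by gcongr
  have hmax := G.sum_c_max_sq_sub_le f
  -- With `τ = t ^ 2`, the four families are the volume of `{f ≥ t}`, minus twice the boundary at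
  -- level `t`, minus twice that at `t / 2`, minus the scaled bound for the ramp energy. The
  -- boundaries cost at most `(2 + 8) * (160 * l * M + M / 80) ≤ 3 * M / 16` and the ramp at most `M
  -- / 4`, so the total integral is positive.
  obtain ⟨τ, hτ, hsum⟩ := exists_pos_sum_indicator_Ioc
    (ι := V ⊕ (V × V) ⊕ (V × V) ⊕ (V × V))
    (Sum.elim (fun v => G.deg v) (Sum.elim (fun p => -2 * G.c p.1 p.2)
      (Sum.elim (fun p => -2 * G.c p.1 p.2)
        (fun p => -(480 * l)⁻¹ * (G.c p.1 p.2 * rampHeight (f p.1) (f p.2))))))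
    (Sum.elim (fun v => 0) (Sum.elim (fun p => f p.1 ^ 2)
      (Sum.elim (fun p => 4 * f p.1 ^ 2) (fun p => rampStart (f p.1) (f p.2)))))
    (Sum.elim (fun v => f v ^ 2) (Sum.elim (fun p => f p.2 ^ 2)
      (Sum.elim (fun p => 4 * f p.2 ^ 2) (fun p => 4 * f p.2 ^ 2))))
    (by
      rintro (v | p | p | p)
      · exact le_rfl
      · exact sq_nonneg _
      · exact mul_nonneg (by norm_num) (sq_nonneg _)
      · exact rampStart_nonneg _ _)
    (by
      simp only [Fintype.sum_sum_type, Sum.elim_inl, Sum.elim_inr, Fintype.sum_prod_type]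
      have e1 : ∑ v, G.deg v * max (f v ^ 2 - 0) 0 = M :=
        Finset.sum_congr rfl fun v _ => by rw [sub_zero, max_eq_left (sq_nonneg _)]
      have e3 : ∀ u v, max (4 * f v ^ 2 - 4 * f u ^ 2) 0 = 4 * max (f v ^ 2 - f u ^ 2) 0 := by
        intro u v
        rw [mul_max_of_nonneg _ _ (by norm_num : (0 : ℝ) ≤ 4)]; ring_nf
      have e4 : ∑ u, ∑ v, G.c u v *
          (rampHeight (f u) (f v) * max (4 * f v ^ 2 - rampStart (f u) (f v)) 0) ≤
          120 * (l * M) := by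
        calc _ ≤ ∑ u, ∑ v, 60 * (G.c u v * (f v - f u) ^ 2) := by
              refine Finset.sum_le_sum fun u _ => Finset.sum_le_sum fun v _ => ?_
              have := mul_le_mul_of_nonneg_left (rampHeight_mul_le (q := f v) (hf u))
                (G.nonneg u v)
              linarith
          _ ≤ 120 * (l * M) := by
              simp only [← Finset.mul_sum]
              rw [G.sum_c_sq_sub f]; linarith
      have e5 : (480 * l)⁻¹ * ∑ u, ∑ v, G.c u v *
          (rampHeight (f u) (f v) * max (4 * f v ^ 2 - rampStart (f u) (f v)) 0) ≤ M / 4 := by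
        calc _ ≤ (480 * l)⁻¹ * (120 * (l * M)) := by gcongr
          _ = M / 4 := by field_simp; norm_num
      simp only [e1, e3, mul_assoc, neg_mul, Finset.sum_neg_distrib, mul_left_comm _ (4 : ℝ),
        ← Finset.mul_sum] at e5 ⊢
      linarith)
  obtain ⟨t, ht, rfl⟩ : ∃ t : ℝ, 0 < t ∧ t ^ 2 = τ :=
    ⟨√τ, Real.sqrt_pos.mpr hτ, Real.sq_sqrt hτ.le⟩
  have hlt : ∀ v, f v ^ 2 < t ^ 2 ↔ f v < t := fun v => pow_lt_pow_iff_left₀ (hf v) ht.le two_ne_zero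
  have hle : ∀ v, t ^ 2 ≤ f v ^ 2 ↔ t ≤ f v := fun v => pow_le_pow_iff_left₀ ht.le (hf v) two_ne_zero
  have hlt' : ∀ v, 4 * f v ^ 2 < t ^ 2 ↔ f v < t / 2 := fun v => by
    rw [show 4 * f v ^ 2 = (2 * f v) ^ 2 by ring,
      pow_lt_pow_iff_left₀ (by linarith [hf v]) ht.le two_ne_zero, lt_div_iff₀' two_pos]
  have hle' : ∀ v, t ^ 2 ≤ 4 * f v ^ 2 ↔ t / 2 ≤ f v := fun v => by
    rw [← not_lt, hlt', not_lt]
  have hr := G.energy_ramp_le hf ht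
  have hcut := G.cut_eq_sum (fun v => f v < t) (fun v => t ≤ f v)
  have hcut' := G.cut_eq_sum (fun v => f v < t / 2) (fun v => t / 2 ≤ f v)
  have hcn : ∀ A B, 0 ≤ G.cut A B := fun A B =>
    Finset.sum_nonneg fun u _ => Finset.sum_nonneg fun v _ => G.nonneg u v
  have hvol : ∑ v, G.deg v * (if 0 < t ^ 2 ∧ t ^ 2 ≤ f v ^ 2 then 1 else 0) =
      G.vol {v | t ≤ f v} := by
    rw [vol, Finset.sum_filter]
    refine Finset.sum_congr rfl fun v _ => ?_
    simp [hle, ht]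
  simp only [Fintype.sum_sum_type, Sum.elim_inl, Sum.elim_inr, Fintype.sum_prod_type,
    mul_assoc, neg_mul, Finset.sum_neg_distrib, ← Finset.mul_sum] at hsum
  simp only [hlt, hle, hlt', hle'] at hsum hvol hr
  rw [hvol, ← hcut, ← hcut'] at hsum
  set R := ∑ u, ∑ v, G.c u v * (rampHeight (f u) (f v) *
    (if rampStart (f u) (f v) < t ^ 2 ∧ t / 2 ≤ f v then 1 else 0))
  have hR0 : 0 ≤ (480 * l)⁻¹ * R := mul_nonneg (by positivity) ((G.energy_nonneg _).trans hr)
  have h1 := hcn {v | f v < t} {v | t ≤ f v}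
  have h2 := hcn {v | f v < t / 2} {v | t / 2 ≤ f v}
  -- All subtracted terms are nonnegative, so each of them separately is below the volume.
  refine ⟨t, ht, by linarith, by linarith, by linarith, hr.trans ?_⟩
  rw [← inv_mul_le_iff₀ (by positivity)]
  linarith

end Sweep

end WeightedGraph

namespace WeightedGraph

/-! ### Weighted medians. -/

section Median

variable {V : Type*} [Fintype V]

/-- A weighted median of `x`. -/
theorem exists_median [Nonempty V] (G : WeightedGraph V) (x : V → ℝ) :
    ∃ m : ℝ, 2 * G.vol {v | m < x v} ≤ ∑ v, G.deg v ∧ 2 * G.vol {v | x v < m} ≤ ∑ v, G.deg v := by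
  classical
  -- The median is the least value of `x` whose sublevel set carries at least half of the volume.
  set S : Finset V := {v | ∑ u, G.deg u ≤ 2 * G.vol {u | x u ≤ x v}} with hS
  have hvol0 : 0 ≤ ∑ v, G.deg v := Finset.sum_nonneg fun v _ => G.deg_nonneg v
  have hSne : S.Nonempty := by
    obtain ⟨v, -, hv⟩ := Finset.exists_max_image Finset.univ x Finset.univ_nonempty
    refine ⟨v, ?_⟩
    have h1 : (Finset.univ.filter fun u => x u ≤ x v) = Finset.univ :=
      Finset.filter_true_of_mem fun u hu => hv u hu
    rw [hS, Finset.mem_filter, h1, vol]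
    exact ⟨Finset.mem_univ _, by linarith⟩
  obtain ⟨w, hwS, hw⟩ := Finset.exists_min_image S x hSne
  refine ⟨x w, ?_, ?_⟩
  · have h1 := (Finset.mem_filter.mp hwS).2
    have h2 := Finset.sum_filter_add_sum_filter_not Finset.univ (fun u => x u ≤ x w) G.deg
    simp only [not_le] at h2
    simp only [vol] at h1 ⊢
    linarith
  · rcases (Finset.univ.filter fun v => x v < x w).eq_empty_or_nonempty with h0 | h0
    · rw [h0]; simpa [vol] using hvol0
    -- The strict sublevel set lies in the sublevel set of the next smaller value, which by
    -- minimality has less than half of the volume.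
    obtain ⟨z, hz, hzmax⟩ := Finset.exists_max_image _ x h0
    have hzw : x z < x w := (Finset.mem_filter.mp hz).2
    have hzS : z ∉ S := fun h => (hw z h).not_gt hzw
    have h1 : 2 * G.vol {u | x u ≤ x z} < ∑ u, G.deg u := by
      by_contra! h
      exact hzS (Finset.mem_filter.mpr ⟨Finset.mem_univ _, h⟩)
    have h2 : G.vol {v | x v < x w} ≤ G.vol {u | x u ≤ x z} :=
      G.vol_mono fun v hv => Finset.mem_filter.mpr ⟨Finset.mem_univ _, hzmax v hv⟩
    linarith

end Median

/-! ### The upper bound. -/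

section UpperBound

variable {V : Type*} [Fintype V] [DecidableEq V]

/-- Along each edge the increments of the positive and negative parts have opposite signs, so the
cross term is favourable. -/
theorem energy_posPart_add_le (G : WeightedGraph V) (x : V → ℝ) :
    G.energy (fun v => max (x v) 0) + G.energy (fun v => max (-x v) 0) ≤ G.energy x := by
  have h1 := G.two_mul_energy x
  have h2 := G.two_mul_energy (fun v => max (x v) 0)
  have h3 := G.two_mul_energy (fun v => max (-x v) 0)
  have h4 : ∑ v, ∑ u, G.c v u * (max (x v) 0 - max (x u) 0) ^ 2 +
      ∑ v, ∑ u, G.c v u * (max (-x v) 0 - max (-x u) 0) ^ 2 ≤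
      ∑ v, ∑ u, G.c v u * (x v - x u) ^ 2 := by
    simp only [← Finset.sum_add_distrib, ← mul_add]
    refine Finset.sum_le_sum fun v _ => Finset.sum_le_sum fun u _ =>
      mul_le_mul_of_nonneg_left ?_ (G.nonneg v u)
    rcases le_total 0 (x v) with hv | hv <;> rcases le_total 0 (x u) with hu | hu <;>
      simp only [hv, hu, max_eq_left, max_eq_right, neg_nonpos.mpr, neg_nonneg.mpr] <;>
      nlinarith
  linarith

/-- A nonnegative function with Rayleigh quotient at most the spectral gap, whose support
has at most half of the volume. -/
theorem exists_test_function [Nontrivial V] (G : WeightedGraph V) (hG : G.Connected) :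
    ∃ f : V → ℝ, (∀ v, 0 ≤ f v) ∧ 2 * G.vol {v | 0 < f v} ≤ ∑ v, G.deg v ∧
      0 < ∑ v, G.deg v * f v ^ 2 ∧ G.energy f ≤ G.spectralGap * ∑ v, G.deg v * f v ^ 2 := by
  have hleast := (G.isLeast_spectralGap hG).1
  have hl := G.eigenvalue_pos hG hleast
  obtain ⟨y, hy0, hy, hE⟩ := G.exists_eigenvector hG hleast
  obtain ⟨m, hm1, hm2⟩ := G.exists_median y
  have hnn : ∀ g : V → ℝ, 0 ≤ ∑ v, G.deg v * g v ^ 2 := fun g =>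
    Finset.sum_nonneg fun v _ => mul_nonneg (G.deg_nonneg v) (sq_nonneg _)
  have hy2 : 0 < ∑ v, G.deg v * y v ^ 2 := by
    obtain ⟨v, hv⟩ := Function.ne_iff.mp hy0
    exact Finset.sum_pos' (fun v _ => mul_nonneg (G.deg_nonneg v) (sq_nonneg _))
      ⟨v, Finset.mem_univ v, mul_pos (G.deg_pos hG v) (sq_pos_of_ne_zero hv)⟩
  -- Shifting by `m` can only increase the mass, because `y` is orthogonal to the constants.
  have hsq : ∑ v, G.deg v * y v ^ 2 ≤ ∑ v, G.deg v * max (y v - m) 0 ^ 2 +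
      ∑ v, G.deg v * max (-(y v - m)) 0 ^ 2 := by
    have h1 : ∑ v, G.deg v * max (y v - m) 0 ^ 2 + ∑ v, G.deg v * max (-(y v - m)) 0 ^ 2 =
        ∑ v, (G.deg v * y v ^ 2 - 2 * m * (G.deg v * y v) + m ^ 2 * G.deg v) := by
      rw [← Finset.sum_add_distrib]
      refine Finset.sum_congr rfl fun v _ => ?_
      rcases le_total 0 (y v - m) with h | h
      · rw [max_eq_left h, max_eq_right (neg_nonpos.mpr h)]; ring
      · rw [max_eq_right h, max_eq_left (neg_nonneg.mpr h)]; ring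
    rw [h1, Finset.sum_add_distrib, Finset.sum_sub_distrib, ← Finset.mul_sum, ← Finset.mul_sum, hy]
    have : 0 ≤ m ^ 2 * ∑ v, G.deg v :=
      mul_nonneg (sq_nonneg _) (Finset.sum_nonneg fun v _ => G.deg_nonneg v)
    linarith
  have hEn := G.energy_posPart_add_le (fun v => y v - m)
  rw [energy_sub_const, hE] at hEn
  have hE1 := G.energy_nonneg (fun v => max (y v - m) 0)
  have hE2 := G.energy_nonneg (fun v => max (-(y v - m)) 0)
  by_contra! hcon
  have c1 := hcon (fun v => max (y v - m) 0) (fun v => le_max_right _ _) (by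
    simpa [lt_max_iff] using hm1)
  have c2 := hcon (fun v => max (-(y v - m)) 0) (fun v => le_max_right _ _) (by
    simpa [lt_max_iff] using hm2)
  have n1 := hnn (fun v => max (y v - m) 0)
  have n2 := hnn (fun v => max (-(y v - m)) 0)
  have hmul := mul_le_mul_of_nonneg_left hsq hl.le
  rw [mul_add] at hmul
  -- Energies and masses of the two parts add up, so both quotients cannot exceed the gap; a part of
  -- zero mass is no candidate and is treated apart.
  rcases n1.eq_or_lt with e1 | e1 <;> rcases n2.eq_or_lt with e2 | e2
  · linarith
  · have := c2 e2
    rw [← e1, mul_zero] at hmul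
    linarith
  · have := c1 e1
    rw [← e2, mul_zero] at hmul
    linarith
  · have := c1 e1
    have := c2 e2
    linarith

theorem exists_schurConductance_le [Nontrivial V] (G : WeightedGraph V) (hG : G.Connected)
    (hsmall : G.spectralGap ≤ 1 / 25600) :
    ∃ A B : Finset V, A.Nonempty ∧ B.Nonempty ∧ Disjoint A B ∧
      G.schurConductance A B ≤ 960 * G.spectralGap := by
  have hl := G.eigenvalue_pos hG (G.isLeast_spectralGap hG).1
  obtain ⟨f, hf, hhalf, hM, hE⟩ := G.exists_test_function hG
  obtain ⟨t, ht, hpos, hcA, hcB, hramp⟩ := G.exists_threshold hf hl hsmall hM hE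
  set A : Finset V := {v | t ≤ f v} with hA
  set B : Finset V := {v | f v < t / 2} with hB
  have hAc : Aᶜ = ({v | f v < t} : Finset V) := by ext v; simp [hA]
  have hBc : Bᶜ = ({v | t / 2 ≤ f v} : Finset V) := by ext v; simp [hB]
  rw [← hAc, cut_comm] at hcA
  rw [← hBc] at hcB
  have hd : Disjoint A B := by
    rw [Finset.disjoint_left]
    intro v h1 h2
    have h1' := (Finset.mem_filter.mp h1).2
    have h2' := (Finset.mem_filter.mp h2).2
    linarith
  have hAsub : G.vol A ≤ G.vol {v | 0 < f v} := G.vol_mono fun v hv => by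
    have := (Finset.mem_filter.mp hv).2
    exact Finset.mem_filter.mpr ⟨Finset.mem_univ _, by linarith⟩
  have hBsub : G.vol Bᶜ ≤ G.vol {v | 0 < f v} := G.vol_mono fun v hv => by
    rw [hBc] at hv
    have := (Finset.mem_filter.mp hv).2
    exact Finset.mem_filter.mpr ⟨Finset.mem_univ _, by linarith⟩
  have hsum := G.vol_add_vol_compl B
  have hne : ∀ S : Finset V, 0 < G.vol S → S.Nonempty := fun S hS => by
    rw [Finset.nonempty_iff_ne_empty]
    rintro rfl
    simp [vol] at hS
  have hAne := hne A hpos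
  refine ⟨A, B, hAne, hne B (by linarith), hd, ?_⟩
  have hcut := G.schur_cut_le_energy hG hAne hd (fun v => ramp t (f v))
    (fun v hv => ramp_eq_one ht (Finset.mem_filter.mp hv).2)
    (fun v hv => ramp_eq_zero ht (Finset.mem_filter.mp hv).2)
  have hvA := G.vol_sub_cut_le_schur_vol (Finset.subset_union_left (s₁ := A) (s₂ := B))
  have hvB := G.vol_sub_cut_le_schur_vol (Finset.subset_union_right (s₁ := A) (s₂ := B))
  -- `B` has at least half of the total volume and `A` at most half, so `vol B ≥ vol A`; each loses
  -- at most `vol A / 2` to its boundary. This halving turns `480` into `960`.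
  have hmin : G.vol A / 2 ≤ min ((G.schur (A ∪ B)).vol (A.subtype (· ∈ A ∪ B)))
      ((G.schur (A ∪ B)).vol (B.subtype (· ∈ A ∪ B))) :=
    le_min (by linarith) (by linarith)
  rw [schurConductance, div_le_iff₀ (by linarith)]
  have := mul_le_mul_of_nonneg_left hmin (by positivity : 0 ≤ 960 * G.spectralGap)
  linarith

theorem minSchurConductance_le [Nontrivial V] (G : WeightedGraph V) (hG : G.Connected) :
    G.minSchurConductance ≤ 25600 * G.spectralGap := by
  have hl := G.eigenvalue_pos hG (G.isLeast_spectralGap hG).1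
  have hleast := G.isLeast_minSchurConductance
  rcases le_total G.spectralGap (1 / 25600) with h | h
  · obtain ⟨A, B, hA, hB, hd, hle⟩ := G.exists_schurConductance_le hG h
    have := hleast.2 ⟨A, B, hA, hB, hd, rfl⟩
    linarith
  · obtain ⟨A, B, -, -, -, hr⟩ := hleast.1
    have := G.schurConductance_le_one A B
    linarith

end UpperBound

end WeightedGraph

theorem theorem2 {V : Type*} [Fintype V] [DecidableEq V] [Nontrivial V]
    (G : WeightedGraph V) (hG : G.Connected) :
    IsLeast G.nonzeroEigenvalues G.spectralGap ∧
      IsLeast G.schurConductances G.minSchurConductance ∧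
      G.spectralGap / 2 ≤ G.minSchurConductance ∧
      G.minSchurConductance ≤ 25600 * G.spectralGap := by
  refine ⟨G.isLeast_spectralGap hG, G.isLeast_minSchurConductance, ?_,
    G.minSchurConductance_le hG⟩
  obtain ⟨A, B, hA, hB, hd, hr⟩ := G.isLeast_minSchurConductance.1
  rw [hr]
  exact G.spectralGap_div_two_le_schurConductance hG hA hB hd
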